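/- All hypergraphs here are finite, have nonempty (pairwise distinct) edges, and $v_F$, $e_F$ denote the numbers of vertices and edges of $F$; $F\subseteq H$ means $V(F)\subseteq V(H)$ and $E(F)\subseteq E(H)$. Let $H$ be a fixed hypergraph with at least one edge. For $n\in\mathbb N$ and $p\in(0,1)$ let $\mathbb H(n,p)$ be the random hypergraph on the vertex set $[n]=\{1,\dots,n\}$ in which each of the $2^n-1$ nonempty subsets of $[n]$ is an edge with probability $p$, independently of the others (the homogeneous model). Let $Z_H^n$ be the number of subhypergraphs of the complete hypergraph $K_n^*=([n],2^{[n]}\setminus\{\emptyset\})$ that are isomorphic to $H$ and contained in $\mathbb H(n,p)$, and let $$\widetilde Z_H^n=\frac{Z_H^n-\mathbb E[Z_H^n]}{\sqrt{\mathrm{Var}[Z_H^n]}}.$$ **Theorem 5.3.** There exist $\varepsilon>0$, constants $C_1,C_2>0$ and $n_0\in\mathbb N$, all depending only on $H$, such that for all $n\ge n_0$ and all $p\in(0,1)$ with $p<\varepsilon$, $$\frac{C_1}{\min\limits_{F\subseteq H,\ e_F\ge 1} n^{v_F}p^{e_F}}\ \le\ \mathbb E\big[(\widetilde Z_H^n)^4\big]-3\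 \le\ \frac{C_2}{\min\limits_{F\subseteq H,\ e_F\ge 1} n^{v_F}p^{e_F}}.$$ -/

import Mathlib

open MeasureTheory ProbabilityTheory
open scoped Hypergraph

namespace RandomHypergraph

/-- `F ⊆ H`: (not necessarily induced) inclusion of hypergraphs. -/
def IsSub {α : Type*} (F H : Hypergraph α) : Prop :=
  V(F) ⊆ V(H) ∧ E(F) ⊆ E(H)

/-- `F ≃ H`: there is a bijection of the vertex sets under which a set of vertices is an edge of
`F` exactly when its image is an edge of `H`. -/
def Iso {α β : Type*} (F : Hypergraph α) (H : Hypergraph β) : Prop :=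
  ∃ f : V(F) ≃ V(H), ∀ e : Set V(F),
    (Subtype.val '' e : Set α) ∈ E(F) ↔ (Subtype.val '' (f '' e) : Set β) ∈ E(H)

/-- The hypergraph with all `n` vertices and with edge set `S`. -/
def ofEdges {n : ℕ} (S : Set (Set (Fin n))) : Hypergraph (Fin n) where
  vertexSet := Set.univ
  edgeSet := S
  subset_vertexSet_of_mem_edgeSet' := fun _ _ => Set.subset_univ _

/-- The edges that may occur: all nonempty sets of vertices. -/
def possibleEdges (n : ℕ) : Set (Set (Fin n)) := {e | e.Nonempty}

/-- The complete hypergraph `K_n^*` on `n` vertices. -/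
def complete (n : ℕ) : Hypergraph (Fin n) := ofEdges (possibleEdges n)

/-- The homogeneous model: the law of the edge set of the random hypergraph on `n` vertices in which
every nonempty set of vertices is an edge with probability `p`, independently of the others. -/
noncomputable def model (n : ℕ) (p : unitInterval) : Measure (Set (Set (Fin n))) :=
  setBernoulli (possibleEdges n) p

instance finite_hypergraph {α : Type*} [Finite α] : Finite (Hypergraph α) :=
  Finite.of_injective (fun H : Hypergraph α => (V(H), E(H))) (by
    intro F H h
    exact Hypergraph.ext (congrArg Prod.fst h) (congrArg Prod.snd h))

/-- The copies of `H` in `K_n^*`: the subhypergraphs of `K_n^*` that are isomorphic to `H`. -/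
noncomputable def copies {α : Type*} (H : Hypergraph α) (n : ℕ) : Finset (Hypergraph (Fin n)) :=
  (Set.toFinite {H' : Hypergraph (Fin n) | IsSub H' (complete n) ∧ Iso H' H}).toFinset

/-- `Z_H^n`: the number of copies of `H` contained in the random hypergraph, as a function of the
random edge set `S`. -/
noncomputable def count {α : Type*} (H : Hypergraph α) (n : ℕ) (S : Set (Set (Fin n))) : ℝ :=
  ∑ H' ∈ copies H n, Set.indicator {S | IsSub H' (ofEdges S)} (fun _ => (1 : ℝ)) S

/-- The standardization `(X - E[X]) / √Var[X]` of a random variable. -/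
noncomputable def standardize {Ω : Type*} [MeasurableSpace Ω] (μ : Measure Ω) (X : Ω → ℝ) :
    Ω → ℝ :=
  fun ω => (X ω - ∫ ω', X ω' ∂μ) / √(variance X μ)

/-- The subhypergraphs of `H` with at least one edge. -/
def subsWithEdge {α : Type*} (H : Hypergraph α) : Set (Hypergraph α) :=
  {F | IsSub F H ∧ 1 ≤ E(F).ncard}

/-- The minimum of `n^{v_F} p^{e_F}` over the subhypergraphs `F` of `H` with at least one edge. -/
noncomputable def minTerm {α : Type*} (H : Hypergraph α) (n : ℕ) (p : ℝ) : ℝ :=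
  sInf ((fun F : Hypergraph α => (n : ℝ) ^ V(F).ncard * p ^ E(F).ncard) '' subsWithEdge H)

/-- For finite `H` with an edge the infimum in `minTerm` is a minimum. -/
theorem isLeast_minTerm {α : Type*} (H : Hypergraph α) (hV : V(H).Finite) (hE : E(H).Nonempty)
    (n : ℕ) (p : ℝ) :
    IsLeast ((fun F : Hypergraph α => (n : ℝ) ^ V(F).ncard * p ^ E(F).ncard) '' subsWithEdge H)
      (minTerm H n p) := by
  have hEf : E(H).Finite :=
    hV.finite_subsets.subset fun e he => H.subset_vertexSet_of_mem_edgeSet' he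
  have hfin : (subsWithEdge H).Finite := by
    refine Set.Finite.of_finite_image (f := fun F : Hypergraph α => (V(F), E(F))) ?_ ?_
    · refine (hV.finite_subsets.prod hEf.finite_subsets).subset ?_
      rintro _ ⟨F, hF, rfl⟩
      exact ⟨hF.1.1, hF.1.2⟩
    · intro F _ G _ h
      exact Hypergraph.ext (congrArg Prod.fst h) (congrArg Prod.snd h)
  have hne : (subsWithEdge H).Nonempty :=
    ⟨H, ⟨subset_rfl, subset_rfl⟩, (Set.ncard_pos hEf).2 hE⟩
  have hbdd := (hfin.image fun F : Hypergraph α =>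
    (n : ℝ) ^ V(F).ncard * p ^ E(F).ncard).bddBelow
  exact ⟨(hne.image _).csInf_mem (hfin.image _), fun x hx => csInf_le hbdd hx⟩

end RandomHypergraph

/-! Replace copies by embeddings of the vertex set: the sum X of the containment indicators over all
embeddings is |Aut H| times the count, so both have the same standardization. The fourth central
moment of X is T + 3 Var(X)², where T sums the joint cumulants of quadruples of indicators, so the
quantity to bound is T / Var(X)².

A cumulant vanishes if the four edge sets split into two independent groups. Otherwise, for small p,
it is comparable to p to the size of the union, since all other terms carry an extra factor p
(`cumulant₄_bounds`). Let A = n^v p^e and let m be the minimum over subhypergraphs. For the upper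
bounds, the four copies are exposed one at a time: each copy forced to share an edge with its
predecessors contributes A/m instead of A (`sum_linkWeight_le`). For the lower bounds, the copies
share an image of a minimizing subhypergraph. Hence Var(X) ≍ A²/m and T ≍ A⁴/m³, and the quotient is
of order 1/m. -/

namespace RandomHypergraph

/-! ### Moments of sums of containment indicators -/

section Moments

variable {ι : Type*}

/-- The indicator of the event that the random set contains `T`. -/
noncomputable def containsInd (T : Finset ι) (S : Set ι) : ℝ :=
  Set.indicator {S : Set ι | (T : Set ι) ⊆ S} (fun _ => (1 : ℝ)) S

lemma containsInd_mul [DecidableEq ι] (A B : Finset ι) (S : Set ι) :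
    containsInd A S * containsInd B S = containsInd (A ∪ B) S := by
  classical
  simp only [containsInd, Set.indicator_apply, Set.mem_ofPred_eq, Finset.coe_union,
    Set.union_subset_iff]
  by_cases h1 : (A : Set ι) ⊆ S <;> by_cases h2 : (B : Set ι) ⊆ S <;> simp [h1, h2]

/-- The event is a cylinder over the coordinates in `T`, so the product measure factors over them.
-/
lemma setBernoulli_real_superset [Countable ι] {u : Set ι} (p : unitInterval) {T : Finset ι}
    (hT : (T : Set ι) ⊆ u) :
    (setBernoulli u p).real {S | (T : Set ι) ⊆ S} = (p : ℝ) ^ T.card := by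
  classical
  rw [measureReal_def, setBernoulli_apply']
  have h : ((fun P : ι → Prop => {i | P i}) ⁻¹' {S | (T : Set ι) ⊆ S})
      = Set.pi (T : Set ι) (fun _ => {True}) := by
    ext P
    simp [Set.subset_def, Set.mem_pi]
  rw [h, Measure.infinitePi_pi _ (fun _ _ => MeasurableSet.of_discrete)]
  rw [Finset.prod_congr rfl (g := fun _ => (unitInterval.toNNReal p : ENNReal))]
  · simp
  · intro i hi
    have : i ∈ u := hT hi
    simp [this]

variable [Finite ι]

/-- Expectation under the random set measure, as a linear map on all functions. -/
noncomputable def expect (u : Set ι) (p : unitInterval) : (Set ι → ℝ) →ₗ[ℝ] ℝ where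
  toFun f := ∫ S, f S ∂(setBernoulli u p)
  map_add' _ _ := integral_add .of_finite .of_finite
  map_smul' c f := integral_smul c f

lemma expect_containsInd {u : Set ι} (p : unitInterval) {T : Finset ι} (hT : (T : Set ι) ⊆ u) :
    expect u p (containsInd T) = (p : ℝ) ^ T.card := by
  have h : MeasurableSet {S : Set ι | (T : Set ι) ⊆ S} := (Set.toFinite _).measurableSet
  change ∫ S, Set.indicator {S : Set ι | (T : Set ι) ⊆ S} (fun _ => (1 : ℝ)) S
    ∂(setBernoulli u p) = _
  rw [integral_indicator h, setIntegral_const, setBernoulli_real_superset p hT]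
  simp

lemma expect_sum_containsInd {κ : Type*} [Fintype κ] {u : Set ι} (p : unitInterval) {R : κ → Finset ι}
    (hR : ∀ k, (R k : Set ι) ⊆ u) :
    ∫ S, ∑ k, containsInd (R k) S ∂(setBernoulli u p) = ∑ k, (p : ℝ) ^ (R k).card := by
  rw [integral_finsetSum _ (fun _ _ => .of_finite)]
  exact Finset.sum_congr rfl fun k _ => expect_containsInd p (hR k)

variable [DecidableEq ι]

/-- The covariance of the indicators of containing `A` and of containing `B`. -/
noncomputable def cov₂ (p : ℝ) (A B : Finset ι) : ℝ :=
  p ^ (A ∪ B).card - p ^ A.card * p ^ B.card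

/-- The joint cumulant of the indicators of containing `A`, `B`, `C` and `D`. -/
noncomputable def cumulant₄ (p : ℝ) (A B C D : Finset ι) : ℝ :=
  p ^ (A ∪ B ∪ C ∪ D).card
    - (p ^ A.card * p ^ (B ∪ C ∪ D).card + p ^ B.card * p ^ (A ∪ C ∪ D).card
      + p ^ C.card * p ^ (A ∪ B ∪ D).card + p ^ D.card * p ^ (A ∪ B ∪ C).card)
    - (p ^ (A ∪ B).card * p ^ (C ∪ D).card + p ^ (A ∪ C).card * p ^ (B ∪ D).card
      + p ^ (A ∪ D).card * p ^ (B ∪ C).card)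
    + 2 * (p ^ (A ∪ B).card * p ^ C.card * p ^ D.card + p ^ (A ∪ C).card * p ^ B.card * p ^ D.card
      + p ^ (A ∪ D).card * p ^ B.card * p ^ C.card + p ^ (B ∪ C).card * p ^ A.card * p ^ D.card
      + p ^ (B ∪ D).card * p ^ A.card * p ^ C.card + p ^ (C ∪ D).card * p ^ A.card * p ^ B.card)
    - 6 * (p ^ A.card * p ^ B.card * p ^ C.card * p ^ D.card)

lemma expect_centered_two {u : Set ι} (p : unitInterval) {A B : Finset ι}
    (hA : (A : Set ι) ⊆ u) (hB : (B : Set ι) ⊆ u) :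
    expect u p (fun S => (containsInd A S - (p : ℝ) ^ A.card) *
      (containsInd B S - (p : ℝ) ^ B.card)) = cov₂ (p : ℝ) A B := by
  have h0 : expect u p (containsInd (∅ : Finset ι)) = 1 := by
    rw [expect_containsInd _ (by simp)]; simp
  have hf : (fun S => (containsInd A S - (p : ℝ) ^ A.card) *
      (containsInd B S - (p : ℝ) ^ B.card)) = containsInd (A ∪ B)
      - (p : ℝ) ^ A.card • containsInd B - (p : ℝ) ^ B.card • containsInd A
      + ((p : ℝ) ^ A.card * (p : ℝ) ^ B.card) • containsInd (∅ : Finset ι) := by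
    funext S
    have h1 : containsInd (∅ : Finset ι) S = 1 := by simp [containsInd]
    simp only [Pi.add_apply, Pi.sub_apply, Pi.smul_apply, smul_eq_mul, ← containsInd_mul, h1]
    ring
  rw [hf]
  have hAB : ((A ∪ B : Finset ι) : Set ι) ⊆ u := by simp [hA, hB]
  simp only [map_add, map_sub, map_smul, smul_eq_mul, h0, expect_containsInd p hA,
    expect_containsInd p hB, expect_containsInd p hAB, cov₂]
  ring

/-- Moment-cumulant formula for centred variables: only partitions of the four indices without
singletons survive, namely the whole set and the three pairings. -/
lemma expect_centered_four {u : Set ι} (p : unitInterval) {A B C D : Finset ι}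
    (hA : (A : Set ι) ⊆ u) (hB : (B : Set ι) ⊆ u) (hC : (C : Set ι) ⊆ u) (hD : (D : Set ι) ⊆ u) :
    expect u p (fun S => (containsInd A S - (p : ℝ) ^ A.card) *
      ((containsInd B S - (p : ℝ) ^ B.card) * ((containsInd C S - (p : ℝ) ^ C.card) *
      (containsInd D S - (p : ℝ) ^ D.card)))) = cumulant₄ (p : ℝ) A B C D
        + (cov₂ (p : ℝ) A B * cov₂ (p : ℝ) C D + cov₂ (p : ℝ) A C * cov₂ (p : ℝ) B D
          + cov₂ (p : ℝ) A D * cov₂ (p : ℝ) B C) := by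
  have h0 : expect u p (containsInd (∅ : Finset ι)) = 1 := by
    rw [expect_containsInd _ (by simp)]; simp
  set a := (p : ℝ) ^ A.card with ha
  set b := (p : ℝ) ^ B.card with hb
  set c := (p : ℝ) ^ C.card with hc
  set d := (p : ℝ) ^ D.card with hd
  -- Products of indicators are indicators of unions, and the empty set supplies the constant 1;
  -- linearity then applies.
  have hf : (fun S => (containsInd A S - a) *
      ((containsInd B S - b) * ((containsInd C S - c) * (containsInd D S - d))))
      = containsInd (A ∪ B ∪ C ∪ D)
      - a • containsInd (B ∪ C ∪ D) - b • containsInd (A ∪ C ∪ D)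
      - c • containsInd (A ∪ B ∪ D) - d • containsInd (A ∪ B ∪ C)
      + (a * b) • containsInd (C ∪ D) + (a * c) • containsInd (B ∪ D)
      + (a * d) • containsInd (B ∪ C) + (b * c) • containsInd (A ∪ D)
      + (b * d) • containsInd (A ∪ C) + (c * d) • containsInd (A ∪ B)
      - (a * b * c) • containsInd D - (a * b * d) • containsInd C
      - (a * c * d) • containsInd B - (b * c * d) • containsInd A
      + (a * b * c * d) • containsInd (∅ : Finset ι) := by
    funext S
    have h1 : containsInd (∅ : Finset ι) S = 1 := by simp [containsInd]
    simp only [Pi.add_apply, Pi.sub_apply, Pi.smul_apply, smul_eq_mul, ← containsInd_mul, h1]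
    ring
  rw [hf]
  have key : ∀ T : Finset ι, T ⊆ A ∪ B ∪ C ∪ D →
      expect u p (containsInd T) = (p : ℝ) ^ T.card := fun T hT =>
    expect_containsInd p (fun x hx => by
      have := hT hx
      simp only [Finset.mem_union] at this
      rcases this with ((h | h) | h) | h
      exacts [hA h, hB h, hC h, hD h])
  simp only [map_add, map_sub, map_smul, smul_eq_mul, h0]
  rw [key (A ∪ B ∪ C ∪ D) (by grind), key (B ∪ C ∪ D) (by grind), key (A ∪ C ∪ D) (by grind),
    key (A ∪ B ∪ D) (by grind), key (A ∪ B ∪ C) (by grind), key (C ∪ D) (by grind),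
    key (B ∪ D) (by grind), key (B ∪ C) (by grind), key (A ∪ D) (by grind), key (A ∪ C) (by grind),
    key (A ∪ B) (by grind), key A (by grind), key B (by grind), key C (by grind), key D (by grind)]
  simp only [cov₂, cumulant₄, ← ha, ← hb, ← hc, ← hd]
  ring

variable {κ : Type*} [Fintype κ]

lemma variance_sum_containsInd {u : Set ι} (p : unitInterval) {R : κ → Finset ι}
    (hR : ∀ k, (R k : Set ι) ⊆ u) :
    variance (fun S => ∑ k, containsInd (R k) S) (setBernoulli u p)
      = ∑ i, ∑ j, cov₂ (p : ℝ) (R i) (R j) := by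
  rw [variance_eq_integral (Measurable.of_discrete).aemeasurable, expect_sum_containsInd p hR]
  have hf : (fun S : Set ι => (∑ k, containsInd (R k) S - ∑ k, (p : ℝ) ^ (R k).card) ^ 2)
      = ∑ i, ∑ j, fun S => (containsInd (R i) S - (p : ℝ) ^ (R i).card) *
      (containsInd (R j) S - (p : ℝ) ^ (R j).card) := by
    funext S
    simp only [Finset.sum_apply, ← Finset.mul_sum, ← Finset.sum_mul, ← Finset.sum_sub_distrib]
    ring
  change expect u p _ = _
  rw [hf]
  simp only [map_sum, expect_centered_two p (hR _) (hR _)]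

lemma fourth_moment_sum_containsInd {u : Set ι} (p : unitInterval) {R : κ → Finset ι}
    (hR : ∀ k, (R k : Set ι) ⊆ u) :
    ∫ S, (∑ k, containsInd (R k) S
        - ∫ S', ∑ k, containsInd (R k) S' ∂(setBernoulli u p)) ^ 4 ∂(setBernoulli u p)
      = ∑ i, ∑ j, ∑ k, ∑ l, cumulant₄ (p : ℝ) (R i) (R j) (R k) (R l)
        + 3 * variance (fun S => ∑ k, containsInd (R k) S) (setBernoulli u p) ^ 2 := by
  rw [variance_sum_containsInd p hR, expect_sum_containsInd p hR]
  have hf : (fun S : Set ι => (∑ k, containsInd (R k) S - ∑ k, (p : ℝ) ^ (R k).card) ^ 4)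
      = ∑ i, ∑ j, ∑ k, ∑ l, fun S => (containsInd (R i) S - (p : ℝ) ^ (R i).card) *
      ((containsInd (R j) S - (p : ℝ) ^ (R j).card) *
      ((containsInd (R k) S - (p : ℝ) ^ (R k).card) *
      (containsInd (R l) S - (p : ℝ) ^ (R l).card))) := by
    funext S
    simp only [Finset.sum_apply, ← Finset.mul_sum, ← Finset.sum_mul, ← Finset.sum_sub_distrib]
    ring
  change expect u p _ = _
  rw [hf]
  simp only [map_sum, expect_centered_four p (hR _) (hR _) (hR _) (hR _), Finset.sum_add_distrib]
  congr 1
  -- Each of the three pairings sums to the squared variance.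
  have h1 : ∀ c : κ → κ → ℝ, ∑ i, ∑ j, ∑ k, ∑ l, c i j * c k l = (∑ i, ∑ j, c i j) ^ 2 := by
    intro c
    simp only [← Finset.mul_sum, ← Finset.sum_mul]
    ring
  have h2 : ∀ c : κ → κ → ℝ, ∑ i, ∑ j, ∑ k, ∑ l, c i k * c j l = (∑ i, ∑ j, c i j) ^ 2 := by
    intro c
    simp only [← Finset.mul_sum, ← Finset.sum_mul]
    ring
  have h3 : ∀ c : κ → κ → ℝ, ∑ i, ∑ j, ∑ k, ∑ l, c i l * c j k = (∑ i, ∑ j, c i j) ^ 2 := by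
    intro c
    simp only [← Finset.mul_sum, ← Finset.sum_mul]
    ring
  rw [h1 fun i j => cov₂ (p : ℝ) (R i) (R j), h2 fun i j => cov₂ (p : ℝ) (R i) (R j),
    h3 fun i j => cov₂ (p : ℝ) (R i) (R j)]
  ring

end Moments

/-! ### Vanishing and size of the joint cumulants -/

section Cumulants

variable {ι : Type*} [DecidableEq ι]

/-- `A`, `B`, `C`, `D` do not split into two nonempty groups with disjoint unions. -/
def Entangled (A B C D : Finset ι) : Prop :=
  (¬ Disjoint A (B ∪ C ∪ D) ∧ ¬ Disjoint B (A ∪ C ∪ D) ∧ ¬ Disjoint C (A ∪ B ∪ D) ∧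
    ¬ Disjoint D (A ∪ B ∪ C)) ∧
  ¬ Disjoint (A ∪ B) (C ∪ D) ∧ ¬ Disjoint (A ∪ C) (B ∪ D) ∧ ¬ Disjoint (A ∪ D) (B ∪ C)

/-- Adjacent transpositions generate all permutations, so a vanishing argument is needed for only
one split of each shape. -/
lemma cumulant₄_swap₁₂ (p : ℝ) (A B C D : Finset ι) :
    cumulant₄ p A B C D = cumulant₄ p B A C D := by
  simp only [cumulant₄, Finset.union_comm, Finset.union_left_comm]
  ring

lemma cumulant₄_swap₂₃ (p : ℝ) (A B C D : Finset ι) :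
    cumulant₄ p A B C D = cumulant₄ p A C B D := by
  simp only [cumulant₄, Finset.union_comm, Finset.union_left_comm]
  ring

lemma cumulant₄_swap₃₄ (p : ℝ) (A B C D : Finset ι) :
    cumulant₄ p A B C D = cumulant₄ p A B D C := by
  simp only [cumulant₄, Finset.union_comm, Finset.union_left_comm]
  ring

lemma pow_card_of_disjoint (p : ℝ) {X Y Z : Finset ι} (h : Disjoint X Y) (hZ : Z = X ∪ Y) :
    p ^ Z.card = p ^ X.card * p ^ Y.card := by
  rw [hZ, Finset.card_union_of_disjoint h, pow_add]

lemma cumulant₄_eq_zero_of_disjoint_one (p : ℝ) {A B C D : Finset ι}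
    (h : Disjoint A (B ∪ C ∪ D)) : cumulant₄ p A B C D = 0 := by
  have hs : ∀ Y, Y ⊆ B ∪ C ∪ D → Disjoint A Y := fun Y hY => h.mono_right hY
  simp only [cumulant₄]
  rw [pow_card_of_disjoint p (Z := A ∪ B ∪ C ∪ D) h (by grind),
    pow_card_of_disjoint p (Z := A ∪ C ∪ D) (hs (C ∪ D) (by grind)) (by grind),
    pow_card_of_disjoint p (Z := A ∪ B ∪ D) (hs (B ∪ D) (by grind)) (by grind),
    pow_card_of_disjoint p (Z := A ∪ B ∪ C) (hs (B ∪ C) (by grind)) (by grind),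
    pow_card_of_disjoint p (Z := A ∪ B) (hs B (by grind)) rfl,
    pow_card_of_disjoint p (Z := A ∪ C) (hs C (by grind)) rfl,
    pow_card_of_disjoint p (Z := A ∪ D) (hs D (by grind)) rfl]
  ring

lemma cumulant₄_eq_zero_of_disjoint_two (p : ℝ) {A B C D : Finset ι}
    (h : Disjoint (A ∪ B) (C ∪ D)) : cumulant₄ p A B C D = 0 := by
  have hs : ∀ X Y, X ⊆ A ∪ B → Y ⊆ C ∪ D → Disjoint X Y := fun X Y hX hY => h.mono hX hY
  simp only [cumulant₄]
  rw [pow_card_of_disjoint p (Z := A ∪ B ∪ C ∪ D) h (by grind),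
    pow_card_of_disjoint p (Z := A ∪ C ∪ D) (hs A (C ∪ D) (by grind) (by grind)) (by grind),
    pow_card_of_disjoint p (Z := B ∪ C ∪ D) (hs B (C ∪ D) (by grind) (by grind)) (by grind),
    pow_card_of_disjoint p (Z := A ∪ B ∪ C) (hs (A ∪ B) C (by grind) (by grind)) (by grind),
    pow_card_of_disjoint p (Z := A ∪ B ∪ D) (hs (A ∪ B) D (by grind) (by grind)) (by grind),
    pow_card_of_disjoint p (Z := A ∪ C) (hs A C (by grind) (by grind)) rfl,
    pow_card_of_disjoint p (Z := A ∪ D) (hs A D (by grind) (by grind)) rfl,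
    pow_card_of_disjoint p (Z := B ∪ C) (hs B C (by grind) (by grind)) rfl,
    pow_card_of_disjoint p (Z := B ∪ D) (hs B D (by grind) (by grind)) rfl]
  ring

/-- A joint cumulant is zero once the variables split into two independent groups; up to symmetry
the split is one against three or two against two. -/
lemma cumulant₄_eq_zero (p : ℝ) {A B C D : Finset ι} (h : ¬ Entangled A B C D) :
    cumulant₄ p A B C D = 0 := by
  simp only [Entangled, not_and_or, not_not] at h
  rcases h with (h | h | h | h) | h | h | h
  · exact cumulant₄_eq_zero_of_disjoint_one p h
  · rw [cumulant₄_swap₁₂]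
    exact cumulant₄_eq_zero_of_disjoint_one p h
  · rw [cumulant₄_swap₂₃, cumulant₄_swap₁₂]
    exact cumulant₄_eq_zero_of_disjoint_one p h
  · rw [cumulant₄_swap₃₄, cumulant₄_swap₂₃, cumulant₄_swap₁₂]
    exact cumulant₄_eq_zero_of_disjoint_one p h
  · exact cumulant₄_eq_zero_of_disjoint_two p h
  · rw [cumulant₄_swap₂₃]
    exact cumulant₄_eq_zero_of_disjoint_two p h
  · rw [cumulant₄_swap₃₄, cumulant₄_swap₂₃]
    exact cumulant₄_eq_zero_of_disjoint_two p h

lemma card_union_lt_of_not_disjoint {X Y Z : Finset ι} (h : ¬ Disjoint X Y) (hZ : Z = X ∪ Y) :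
    Z.card < X.card + Y.card := by
  subst hZ
  have h1 := Finset.card_union_add_card_inter X Y
  have h2 : 0 < (X ∩ Y).card := Finset.card_pos.2 (Finset.not_disjoint_iff_nonempty_inter.1 h)
  omega

/-- Every product other than the leading power has a strictly larger exponent, because the parts of
some split overlap. The negative coefficients total 4 + 3 + 6 = 13, the positive ones 2 · 6 = 12. -/
lemma cumulant₄_bounds {p : ℝ} (hp0 : 0 ≤ p) (hp1 : p ≤ 1) {A B C D : Finset ι}
    (h : Entangled A B C D) :
    (1 - 13 * p) * p ^ (A ∪ B ∪ C ∪ D).card ≤ cumulant₄ p A B C D ∧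
      cumulant₄ p A B C D ≤ (1 + 12 * p) * p ^ (A ∪ B ∪ C ∪ D).card := by
  obtain ⟨⟨hA, hB, hC, hD⟩, hAB, hAC, hAD⟩ := h
  have cA := card_union_lt_of_not_disjoint (Z := A ∪ B ∪ C ∪ D) hA (by grind)
  have cB := card_union_lt_of_not_disjoint (Z := A ∪ B ∪ C ∪ D) hB (by grind)
  have cC := card_union_lt_of_not_disjoint (Z := A ∪ B ∪ C ∪ D) hC (by grind)
  have cD := card_union_lt_of_not_disjoint (Z := A ∪ B ∪ C ∪ D) hD (by grind)
  have cAB := card_union_lt_of_not_disjoint (Z := A ∪ B ∪ C ∪ D) hAB (by grind)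
  have cAC := card_union_lt_of_not_disjoint (Z := A ∪ B ∪ C ∪ D) hAC (by grind)
  have cAD := card_union_lt_of_not_disjoint (Z := A ∪ B ∪ C ∪ D) hAD (by grind)
  have u1 := Finset.card_union_le A B
  have u2 := Finset.card_union_le A C
  have u3 := Finset.card_union_le A D
  have u4 := Finset.card_union_le B C
  have u5 := Finset.card_union_le B D
  have u6 := Finset.card_union_le C D
  have key : ∀ k, (A ∪ B ∪ C ∪ D).card < k → 0 ≤ p ^ k ∧ p ^ k ≤ p * p ^ (A ∪ B ∪ C ∪ D).card := by
    intro k hk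
    refine ⟨by positivity, ?_⟩
    rw [← pow_succ']
    exact pow_le_pow_of_le_one hp0 hp1 hk
  simp only [cumulant₄, ← pow_add]
  have k1 := key _ cA
  have k2 := key _ cB
  have k3 := key _ cC
  have k4 := key _ cD
  have k5 := key _ cAB
  have k6 := key _ cAC
  have k7 := key _ cAD
  -- Merging singletons reduces these finer partitions to a two-against-two split.
  have l1 := key ((A ∪ B).card + C.card + D.card) (by omega)
  have l2 := key ((A ∪ C).card + B.card + D.card) (by omega)
  have l3 := key ((A ∪ D).card + B.card + C.card) (by omega)
  have l4 := key ((B ∪ C).card + A.card + D.card) (by omega)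
  have l5 := key ((B ∪ D).card + A.card + C.card) (by omega)
  have l6 := key ((C ∪ D).card + A.card + B.card) (by omega)
  have l7 := key (A.card + B.card + C.card + D.card) (by omega)
  constructor <;> linarith

lemma cov₂_eq_zero (p : ℝ) {A B : Finset ι} (h : Disjoint A B) : cov₂ p A B = 0 := by
  rw [cov₂, pow_card_of_disjoint p h rfl, sub_self]

lemma cov₂_bounds {p : ℝ} (hp0 : 0 ≤ p) (hp1 : p ≤ 1) {A B : Finset ι} (h : ¬ Disjoint A B) :
    (1 - p) * p ^ (A ∪ B).card ≤ cov₂ p A B ∧ cov₂ p A B ≤ p ^ (A ∪ B).card := by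
  have h1 : p ^ (A.card + B.card) ≤ p ^ ((A ∪ B).card + 1) :=
    pow_le_pow_of_le_one hp0 hp1 (card_union_lt_of_not_disjoint h rfl)
  have h2 : 0 ≤ p ^ (A.card + B.card) := by positivity
  rw [pow_succ'] at h1
  rw [cov₂, ← pow_add]
  constructor <;> linarith

end Cumulants

/-! ### Exposing four sets one after another -/

section Chains

variable {ι : Type*} [DecidableEq ι]

/-- The weight `p ^ |A \ S|` of the part of `A` outside `S` if `A` meets `S`, and `0` otherwise. -/
noncomputable def linkWeight (p : ℝ) (A S : Finset ι) : ℝ :=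
  if Disjoint A S then 0 else p ^ (A \ S).card

lemma linkWeight_nonneg {p : ℝ} (hp : 0 ≤ p) (A S : Finset ι) : 0 ≤ linkWeight p A S := by
  unfold linkWeight
  split_ifs <;> positivity

/-- The weight of exposing `A`, `B`, `C`, `D` one after the other, each meeting the union of its
predecessors. -/
noncomputable def chainWeight (p : ℝ) (A B C D : Finset ι) : ℝ :=
  p ^ A.card * (linkWeight p B A * (linkWeight p C (A ∪ B) * linkWeight p D (A ∪ B ∪ C)))

lemma chainWeight_nonneg {p : ℝ} (hp : 0 ≤ p) (A B C D : Finset ι) :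
    0 ≤ chainWeight p A B C D := by
  unfold chainWeight
  have := linkWeight_nonneg hp B A
  have := linkWeight_nonneg hp C (A ∪ B)
  have := linkWeight_nonneg hp D (A ∪ B ∪ C)
  positivity

lemma chainWeight_eq (p : ℝ) {A B C D : Finset ι} (hB : ¬ Disjoint B A)
    (hC : ¬ Disjoint C (A ∪ B)) (hD : ¬ Disjoint D (A ∪ B ∪ C)) :
    chainWeight p A B C D = p ^ (A ∪ B ∪ C ∪ D).card := by
  simp only [chainWeight, linkWeight, if_neg hB, if_neg hC, if_neg hD, ← pow_add]
  congr 1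
  have h : ∀ X Y : Finset ι, (X ∪ Y).card = X.card + (Y \ X).card := fun X Y => by
    rw [← Finset.union_sdiff_self_eq_union, Finset.card_union_of_disjoint Finset.disjoint_sdiff]
  rw [h (A ∪ B ∪ C) D, h (A ∪ B) C, h A B]
  ring

/-- Starting from `A`, some order has each set meeting the union of its predecessors: `A` is not
isolated, the pair reached is not separated from the rest, and the last set is not isolated. Summing
over all six orders avoids choosing one. -/
lemma pow_card_le_sum_chainWeight {p : ℝ} (hp : 0 ≤ p) {A B C D : Finset ι}
    (h : Entangled A B C D) :
    p ^ (A ∪ B ∪ C ∪ D).card ≤ chainWeight p A B C D + chainWeight p A B D C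
      + chainWeight p A C B D + chainWeight p A C D B + chainWeight p A D B C
      + chainWeight p A D C B := by
  obtain ⟨⟨hA, hB, hC, hD⟩, hAB, hAC, hAD⟩ := h
  have n1 := chainWeight_nonneg hp A B C D
  have n2 := chainWeight_nonneg hp A B D C
  have n3 := chainWeight_nonneg hp A C B D
  have n4 := chainWeight_nonneg hp A C D B
  have n5 := chainWeight_nonneg hp A D B C
  have n6 := chainWeight_nonneg hp A D C B
  have d1 : ¬ Disjoint B (A ∪ D ∪ C) := by rwa [Finset.union_right_comm]
  have d2 : ¬ Disjoint D (A ∪ C ∪ B) := by rwa [Finset.union_right_comm]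
  have d3 : ¬ Disjoint C (A ∪ D ∪ B) := by rwa [Finset.union_right_comm]
  have e2 : A ∪ B ∪ C ∪ D = A ∪ B ∪ D ∪ C := by grind
  have e3 : A ∪ B ∪ C ∪ D = A ∪ C ∪ B ∪ D := by grind
  have e4 : A ∪ B ∪ C ∪ D = A ∪ C ∪ D ∪ B := by grind
  have e5 : A ∪ B ∪ C ∪ D = A ∪ D ∪ B ∪ C := by grind
  have e6 : A ∪ B ∪ C ∪ D = A ∪ D ∪ C ∪ B := by grind
  rw [Finset.disjoint_union_right, Finset.disjoint_union_right, not_and_or, not_and_or] at hA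
  rcases hA with (h | h) | h
  · rw [Finset.disjoint_union_right, not_and_or] at hAB
    rcases hAB with h' | h'
    · have := chainWeight_eq p (disjoint_comm.not.1 h) (disjoint_comm.not.1 h') hD
      linarith
    · have := chainWeight_eq p (disjoint_comm.not.1 h) (disjoint_comm.not.1 h') hC
      rw [e2]; linarith
  · rw [Finset.disjoint_union_right, not_and_or] at hAC
    rcases hAC with h' | h'
    · have := chainWeight_eq p (disjoint_comm.not.1 h) (disjoint_comm.not.1 h') d2
      rw [e3]; linarith
    · have := chainWeight_eq p (disjoint_comm.not.1 h) (disjoint_comm.not.1 h') hB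
      rw [e4]; linarith
  · rw [Finset.disjoint_union_right, not_and_or] at hAD
    rcases hAD with h' | h'
    · have := chainWeight_eq p (disjoint_comm.not.1 h) (disjoint_comm.not.1 h') d3
      rw [e5]; linarith
    · have := chainWeight_eq p (disjoint_comm.not.1 h) (disjoint_comm.not.1 h') d1
      rw [e6]; linarith

end Chains

/-! ### Upper bounds for sums over embeddings -/

section Embeddings

open scoped Classical

variable {V : Type*} {n : ℕ}

/-- The image of a family of sets of vertices under an embedding. -/
noncomputable def edgeImage (D : Finset (Set V)) (f : V ↪ Fin n) : Finset (Set (Fin n)) :=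
  D.image (fun e => f '' e)

lemma card_edgeImage (D : Finset (Set V)) (f : V ↪ Fin n) : (edgeImage D f).card = D.card :=
  Finset.card_image_of_injective _ f.injective.image_injective

variable [Fintype V]

/-- Passing from embeddings to all maps makes the sum factor over the vertices. -/
lemma sum_pow_card_preimage_le (W : Finset (Fin n)) (x : ℝ) (hx : 0 ≤ x) :
    ∑ f : V ↪ Fin n, x ^ (Finset.univ.filter fun v => f v ∈ W).card
      ≤ (W.card * x + n) ^ Fintype.card V := by
  have h1 : ∑ f : V → Fin n, ∏ v, (if f v ∈ W then x else 1)
      = ∏ _v : V, ∑ y : Fin n, (if y ∈ W then x else 1) := by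
    rw [Finset.prod_univ_sum, Fintype.piFinset_univ]
  have h2 : ∑ y : Fin n, (if y ∈ W then x else 1) ≤ W.card * x + n := by
    calc ∑ y : Fin n, (if y ∈ W then x else 1)
        ≤ ∑ y : Fin n, ((if y ∈ W then x else 0) + 1) := by
          refine Finset.sum_le_sum fun y _ => ?_
          split_ifs <;> linarith
      _ = W.card * x + n := by simp [Finset.sum_add_distrib]
  have h0 : 0 ≤ ∑ y : Fin n, (if y ∈ W then x else 1) :=
    Finset.sum_nonneg fun y _ => by split_ifs <;> linarith
  calc ∑ f : V ↪ Fin n, x ^ (Finset.univ.filter fun v => f v ∈ W).card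
      = ∑ f : V ↪ Fin n, ∏ v, (if f v ∈ W then x else 1) := by
        refine Finset.sum_congr rfl fun f _ => ?_
        rw [Finset.prod_ite, Finset.prod_const, Finset.prod_const_one, mul_one]
    _ ≤ ∑ f : V → Fin n, ∏ v, (if f v ∈ W then x else 1) := by
        refine (Finset.sum_map Finset.univ (⟨fun f : V ↪ Fin n => (f : V → Fin n),
          DFunLike.coe_injective⟩ : (V ↪ Fin n) ↪ (V → Fin n))
          (fun f => ∏ v, (if f v ∈ W then x else 1))).symm.trans_le ?_
        refine Finset.sum_le_sum_of_subset_of_nonneg (Finset.subset_univ _) fun f _ _ => ?_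
        exact Finset.prod_nonneg fun v _ => by split_ifs <;> linarith
    _ ≤ (W.card * x + n) ^ Fintype.card V := by
        rw [h1, Finset.prod_const, Finset.card_univ]
        exact pow_le_pow_left₀ h0 h2 _

/-- `m` is a lower bound for `n ^ |U| * p ^ |D'|` over the sets of vertices `U` and the nonempty
families `D'` of edges inside `U`. -/
def IsSubBound (D : Finset (Set V)) (n : ℕ) (p m : ℝ) : Prop :=
  ∀ U : Finset V, ∀ D' ⊆ D, D'.Nonempty → (∀ e ∈ D', e ⊆ (U : Set V)) →
    m ≤ (n : ℝ) ^ U.card * p ^ D'.card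

/-- The edges sent into `S` lie inside U, the preimage of `W`. If there are j ≥ 1 of them, then m ≤
n^|U| p^j, so the link weight is at most (p^|D| / m) n^|U|. The factor n for each vertex landing in
`W` makes up for its having only |W| possible images. -/
lemma sum_linkWeight_le {D : Finset (Set V)} {p m : ℝ} (hp : 0 < p) (hm : 0 < m)
    (hmin : IsSubBound D n p m) {S : Finset (Set (Fin n))} {W : Finset (Fin n)}
    (hSW : ∀ s ∈ S, s ⊆ (W : Set (Fin n))) {K : ℕ} (hK : W.card ≤ K) :
    ∑ f : V ↪ Fin n, linkWeight p (edgeImage D f) S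
      ≤ ((K : ℝ) + 1) ^ Fintype.card V * ((n : ℝ) ^ Fintype.card V * p ^ D.card / m) := by
  have key : ∀ f : V ↪ Fin n, linkWeight p (edgeImage D f) S
      ≤ p ^ D.card / m * (n : ℝ) ^ (Finset.univ.filter fun v => f v ∈ W).card := by
    intro f
    unfold linkWeight
    split_ifs with hd
    · positivity
    set D' := D.filter (fun e => f '' e ∈ S) with hD'
    have hcard : (edgeImage D f \ S).card + D'.card = D.card := by
      have h1 : edgeImage D f \ S = edgeImage (D.filter (fun e => f '' e ∉ S)) f := by
        ext s
        simp only [edgeImage, Finset.mem_sdiff, Finset.mem_image, Finset.mem_filter]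
        constructor
        · rintro ⟨⟨e, he, rfl⟩, h⟩
          exact ⟨e, ⟨he, h⟩, rfl⟩
        · rintro ⟨e, ⟨he, h⟩, rfl⟩
          exact ⟨⟨e, he, rfl⟩, h⟩
      rw [h1, card_edgeImage, add_comm]
      exact Finset.card_filter_add_card_filter_not _
    have hne : D'.Nonempty := by
      obtain ⟨s, hs, hsS⟩ := Finset.not_disjoint_iff.1 hd
      obtain ⟨e, he, rfl⟩ := Finset.mem_image.1 hs
      exact ⟨e, Finset.mem_filter.2 ⟨he, hsS⟩⟩
    have hb := hmin (Finset.univ.filter fun v => f v ∈ W) D' (Finset.filter_subset _ _) hne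
      (fun e he v hv => by
        have := hSW _ (Finset.mem_filter.1 he).2 ⟨v, hv, rfl⟩
        simpa using this)
    rw [div_mul_eq_mul_div, le_div_iff₀ hm, ← hcard, pow_add, mul_assoc]
    refine mul_le_mul_of_nonneg_left ?_ (by positivity)
    rwa [mul_comm]
  calc ∑ f : V ↪ Fin n, linkWeight p (edgeImage D f) S
      ≤ ∑ f : V ↪ Fin n, p ^ D.card / m *
          (n : ℝ) ^ (Finset.univ.filter fun v => f v ∈ W).card :=
        Finset.sum_le_sum fun f _ => key f
    _ ≤ p ^ D.card / m * ((W.card : ℝ) * n + n) ^ Fintype.card V := by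
        rw [← Finset.mul_sum]
        exact mul_le_mul_of_nonneg_left (sum_pow_card_preimage_le W n (by positivity))
          (by positivity)
    _ ≤ p ^ D.card / m * (((K : ℝ) + 1) * n) ^ Fintype.card V := by
        have : (W.card : ℝ) ≤ K := by exact_mod_cast hK
        gcongr
        nlinarith [(Nat.cast_nonneg n : (0 : ℝ) ≤ n)]
    _ = _ := by
        rw [mul_pow]
        ring

/-- The vertices covered by an embedding. -/
def rangeFinset (f : V ↪ Fin n) : Finset (Fin n) := Finset.univ.map f

lemma subset_rangeFinset {D : Finset (Set V)} {f : V ↪ Fin n} {s : Set (Fin n)}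
    (hs : s ∈ edgeImage D f) : s ⊆ (rangeFinset f : Set (Fin n)) := by
  obtain ⟨e, -, rfl⟩ := Finset.mem_image.1 hs
  rintro _ ⟨v, -, rfl⟩
  simp [rangeFinset]

lemma card_rangeFinset (f : V ↪ Fin n) : (rangeFinset f).card = Fintype.card V := by
  simp [rangeFinset]

lemma card_embedding_le_pow : (Fintype.card (V ↪ Fin n) : ℝ) ≤ (n : ℝ) ^ Fintype.card V := by
  rw [Fintype.card_embedding_eq, Fintype.card_fin]
  exact_mod_cast Nat.descFactorial_le_pow _ _

lemma sum_cov₂_le {D : Finset (Set V)} {p m : ℝ} (hp : 0 < p) (hp1 : p ≤ 1) (hm : 0 < m)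
    (hmin : IsSubBound D n p m) :
    ∑ f : V ↪ Fin n, ∑ g : V ↪ Fin n, cov₂ p (edgeImage D f) (edgeImage D g)
      ≤ ((Fintype.card V : ℝ) + 1) ^ Fintype.card V *
        (((n : ℝ) ^ Fintype.card V * p ^ D.card) ^ 2 / m) := by
  have h1 : ∀ A B : Finset (Set (Fin n)), cov₂ p A B ≤ p ^ A.card * linkWeight p B A := by
    intro A B
    unfold linkWeight
    split_ifs with h
    · rw [cov₂_eq_zero p h.symm, mul_zero]
    · refine (cov₂_bounds hp.le hp1 (disjoint_comm.not.1 h)).2.trans_eq ?_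
      rw [← pow_add, ← Finset.union_sdiff_self_eq_union,
        Finset.card_union_of_disjoint Finset.disjoint_sdiff]
  set X := ((Fintype.card V : ℝ) + 1) ^ Fintype.card V *
    ((n : ℝ) ^ Fintype.card V * p ^ D.card / m) with hX
  have hX0 : 0 ≤ X := by positivity
  calc _ ≤ ∑ f : V ↪ Fin n, p ^ D.card * X := by
        refine Finset.sum_le_sum fun f _ => ?_
        refine (Finset.sum_le_sum fun g _ => h1 _ _).trans ?_
        rw [← Finset.mul_sum, card_edgeImage]
        exact mul_le_mul_of_nonneg_left (sum_linkWeight_le hp hm hmin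
          (fun s hs => subset_rangeFinset hs) (card_rangeFinset f).le) (by positivity)
    _ = (Fintype.card (V ↪ Fin n) : ℝ) * (p ^ D.card * X) := by simp
    _ ≤ (n : ℝ) ^ Fintype.card V * (p ^ D.card * X) :=
        mul_le_mul_of_nonneg_right card_embedding_le_pow (by positivity)
    _ = _ := by rw [hX]; ring

/-- Sum from the innermost embedding outwards, each link giving the same bound `X`: at most three
earlier copies cover at most 3|V| vertices. -/
lemma sum_chainWeight_le {D : Finset (Set V)} {p m : ℝ} (hp : 0 < p) (hm : 0 < m)
    (hmin : IsSubBound D n p m) :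
    ∑ f₁ : V ↪ Fin n, ∑ f₂ : V ↪ Fin n, ∑ f₃ : V ↪ Fin n, ∑ f₄ : V ↪ Fin n,
      chainWeight p (edgeImage D f₁) (edgeImage D f₂) (edgeImage D f₃) (edgeImage D f₄)
      ≤ (3 * (Fintype.card V : ℝ) + 1) ^ (3 * Fintype.card V) *
        (((n : ℝ) ^ Fintype.card V * p ^ D.card) ^ 4 / m ^ 3) := by
  set X := (((3 * Fintype.card V : ℕ) : ℝ) + 1) ^ Fintype.card V *
    ((n : ℝ) ^ Fintype.card V * p ^ D.card / m) with hX
  have hX0 : 0 ≤ X := by positivity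
  have hlink : ∀ (S : Finset (Set (Fin n))) (W : Finset (Fin n)),
      (∀ s ∈ S, s ⊆ (W : Set (Fin n))) → W.card ≤ 3 * Fintype.card V →
      ∑ f : V ↪ Fin n, linkWeight p (edgeImage D f) S ≤ X := fun S W hSW hW =>
    sum_linkWeight_le hp hm hmin hSW hW
  have l1 : ∀ f : V ↪ Fin n, ∑ g : V ↪ Fin n, linkWeight p (edgeImage D g) (edgeImage D f) ≤ X :=
    fun f => hlink _ (rangeFinset f) (fun s hs => subset_rangeFinset hs)
      (by rw [card_rangeFinset]; omega)
  have l2 : ∀ f g : V ↪ Fin n,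
      ∑ h : V ↪ Fin n, linkWeight p (edgeImage D h) (edgeImage D f ∪ edgeImage D g) ≤ X := by
    refine fun f g => hlink _ (rangeFinset f ∪ rangeFinset g) (fun s hs => ?_) ?_
    · rw [Finset.coe_union]
      rcases Finset.mem_union.1 hs with h | h
      · exact (subset_rangeFinset h).trans Set.subset_union_left
      · exact (subset_rangeFinset h).trans Set.subset_union_right
    · have := Finset.card_union_le (rangeFinset f) (rangeFinset g)
      simp only [card_rangeFinset] at this
      omega
  have l3 : ∀ f g h : V ↪ Fin n, ∑ k : V ↪ Fin n,
      linkWeight p (edgeImage D k) (edgeImage D f ∪ edgeImage D g ∪ edgeImage D h) ≤ X := by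
    refine fun f g h => hlink _ (rangeFinset f ∪ rangeFinset g ∪ rangeFinset h) (fun s hs => ?_) ?_
    · rw [Finset.coe_union, Finset.coe_union]
      rcases Finset.mem_union.1 hs with hs | hs
      · rcases Finset.mem_union.1 hs with hs | hs
        · exact (subset_rangeFinset hs).trans
            (Set.subset_union_left.trans Set.subset_union_left)
        · exact (subset_rangeFinset hs).trans
            (Set.subset_union_right.trans Set.subset_union_left)
      · exact (subset_rangeFinset hs).trans Set.subset_union_right
    · have h1 := Finset.card_union_le (rangeFinset f) (rangeFinset g)
      have h2 := Finset.card_union_le (rangeFinset f ∪ rangeFinset g) (rangeFinset h)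
      simp only [card_rangeFinset] at h1 h2
      omega
  have hl := fun A S : Finset (Set (Fin n)) => linkWeight_nonneg hp.le A S
  calc _ ≤ ∑ f₁ : V ↪ Fin n, p ^ D.card * (X * (X * X)) := by
        refine Finset.sum_le_sum fun f₁ _ => ?_
        simp only [chainWeight, ← Finset.mul_sum, card_edgeImage]
        refine mul_le_mul_of_nonneg_left ?_ (by positivity)
        refine (Finset.sum_le_sum (g := fun f₂ : V ↪ Fin n =>
          linkWeight p (edgeImage D f₂) (edgeImage D f₁) * (X * X)) fun f₂ _ => ?_).trans ?_
        · refine mul_le_mul_of_nonneg_left ?_ (hl _ _)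
          refine (Finset.sum_le_sum (g := fun f₃ : V ↪ Fin n =>
            linkWeight p (edgeImage D f₃) (edgeImage D f₁ ∪ edgeImage D f₂) * X)
            fun f₃ _ => mul_le_mul_of_nonneg_left (l3 f₁ f₂ f₃) (hl _ _)).trans ?_
          rw [← Finset.sum_mul]
          exact mul_le_mul_of_nonneg_right (l2 f₁ f₂) hX0
        · rw [← Finset.sum_mul]
          exact mul_le_mul_of_nonneg_right (l1 f₁) (by positivity)
    _ = (Fintype.card (V ↪ Fin n) : ℝ) * (p ^ D.card * (X * (X * X))) := by simp
    _ ≤ (n : ℝ) ^ Fintype.card V * (p ^ D.card * (X * (X * X))) :=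
        mul_le_mul_of_nonneg_right card_embedding_le_pow (by positivity)
    _ = _ := by
        have e : (3 * (Fintype.card V : ℝ) + 1) ^ (3 * Fintype.card V) =
          ((3 * (Fintype.card V : ℝ) + 1) ^ Fintype.card V) ^ 3 := by
          rw [mul_comm 3 (Fintype.card V), pow_mul]
        rw [hX, e]
        push_cast
        ring

/-- The constant is 78 = 13 · 6: 1 + 12p ≤ 13, and there are six exposure orders, all with the same
total after relabelling. -/
lemma sum_cumulant₄_le {D : Finset (Set V)} {p m : ℝ} (hp : 0 < p) (hp1 : p ≤ 1) (hm : 0 < m)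
    (hmin : IsSubBound D n p m) :
    ∑ f₁ : V ↪ Fin n, ∑ f₂ : V ↪ Fin n, ∑ f₃ : V ↪ Fin n, ∑ f₄ : V ↪ Fin n,
      cumulant₄ p (edgeImage D f₁) (edgeImage D f₂) (edgeImage D f₃) (edgeImage D f₄)
      ≤ 78 * (3 * (Fintype.card V : ℝ) + 1) ^ (3 * Fintype.card V) *
        (((n : ℝ) ^ Fintype.card V * p ^ D.card) ^ 4 / m ^ 3) := by
  have h1 : ∀ A B C E : Finset (Set (Fin n)), cumulant₄ p A B C E ≤
      13 * (chainWeight p A B C E + chainWeight p A B E C + chainWeight p A C B E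
        + chainWeight p A C E B + chainWeight p A E B C + chainWeight p A E C B) := by
    intro A B C E
    by_cases h : Entangled A B C E
    · have a1 := (cumulant₄_bounds hp.le hp1 h).2
      have a2 := pow_card_le_sum_chainWeight hp.le h
      have a3 : 0 ≤ p ^ (A ∪ B ∪ C ∪ E).card := by positivity
      nlinarith
    · rw [cumulant₄_eq_zero p h]
      have := fun A B C D : Finset (Set (Fin n)) => chainWeight_nonneg hp.le A B C D
      have b1 := this A B C E
      have b2 := this A B E C
      have b3 := this A C B E
      have b4 := this A C E B
      have b5 := this A E B C
      have b6 := this A E C B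
      positivity
  have h2 := sum_chainWeight_le hp hm hmin
  set w : (V ↪ Fin n) → (V ↪ Fin n) → (V ↪ Fin n) → (V ↪ Fin n) → ℝ := fun f₁ f₂ f₃ f₄ =>
    chainWeight p (edgeImage D f₁) (edgeImage D f₂) (edgeImage D f₃) (edgeImage D f₄) with hw
  set T := ∑ f₁, ∑ f₂, ∑ f₃, ∑ f₄, w f₁ f₂ f₃ f₄ with hT
  have t2 : ∑ f₁, ∑ f₂, ∑ f₃, ∑ f₄, w f₁ f₂ f₄ f₃ = T :=
    Finset.sum_congr rfl fun _ _ => Finset.sum_congr rfl fun _ _ => Finset.sum_comm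
  have t3 : ∑ f₁, ∑ f₂, ∑ f₃, ∑ f₄, w f₁ f₃ f₂ f₄ = T :=
    Finset.sum_congr rfl fun _ _ => Finset.sum_comm
  have t4 : ∑ f₁, ∑ f₂, ∑ f₃, ∑ f₄, w f₁ f₃ f₄ f₂ = T := by
    rw [← t2]
    exact Finset.sum_congr rfl fun _ _ => Finset.sum_comm
  have t5 : ∑ f₁, ∑ f₂, ∑ f₃, ∑ f₄, w f₁ f₄ f₂ f₃ = T := by
    rw [← t3]
    exact Finset.sum_congr rfl fun _ _ => Finset.sum_congr rfl fun _ _ => Finset.sum_comm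
  have t6 : ∑ f₁, ∑ f₂, ∑ f₃, ∑ f₄, w f₁ f₄ f₃ f₂ = T := by
    rw [← t4]
    exact Finset.sum_congr rfl fun _ _ => Finset.sum_congr rfl fun _ _ => Finset.sum_comm
  calc _ ≤ ∑ f₁, ∑ f₂, ∑ f₃, ∑ f₄, 13 * (w f₁ f₂ f₃ f₄ + w f₁ f₂ f₄ f₃ + w f₁ f₃ f₂ f₄
        + w f₁ f₃ f₄ f₂ + w f₁ f₄ f₂ f₃ + w f₁ f₄ f₃ f₂) :=
        Finset.sum_le_sum fun _ _ => Finset.sum_le_sum fun _ _ => Finset.sum_le_sum fun _ _ =>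
          Finset.sum_le_sum fun _ _ => h1 _ _ _ _
    _ = 13 * (T + T + T + T + T + T) := by
        simp only [← Finset.mul_sum, Finset.sum_add_distrib, t2, t3, t4, t5, t6, ← hT]
    _ ≤ _ := by linarith

end Embeddings

/-! ### Lower bounds from copies sharing a subhypergraph -/

section LowerBounds

open scoped Classical

variable {V : Type*} [Fintype V] {n : ℕ}

/-- The embeddings that agree with `f` on `U`. -/
noncomputable def agreeing (f : V ↪ Fin n) (U : Finset V) : Finset (V ↪ Fin n) :=
  Finset.univ.filter fun g => ∀ v ∈ U, g v = f v

/-- Reserve disjoint blocks of `k` points, one per vertex. Any choice of one point in each block is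
an embedding, and fixing it on `U` leaves the other blocks free. -/
lemma le_sum_card_agreeing_pow {k : ℕ} (h : Fintype.card V * k ≤ n) (U : Finset V) (r : ℕ) :
    k ^ Fintype.card V * (k ^ (Fintype.card V - U.card)) ^ r
      ≤ ∑ f : V ↪ Fin n, (agreeing f U).card ^ r := by
  obtain ⟨e⟩ : Nonempty (V × Fin k ↪ Fin n) :=
    Function.Embedding.nonempty_of_card_le (by simpa using h)
  let φ : (V → Fin k) ↪ (V ↪ Fin n) :=
    ⟨fun g => ⟨fun v => e (v, g v), fun v w hvw => (Prod.ext_iff.1 (e.injective hvw)).1⟩,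
      fun g g' hg => funext fun v =>
        (Prod.ext_iff.1 (e.injective (DFunLike.congr_fun hg v))).2⟩
  have hφ : ∀ g v, φ g v = e (v, g v) := fun _ _ => rfl
  have hcard : ∀ g : V → Fin k, k ^ (Fintype.card V - U.card) ≤ (agreeing (φ g) U).card := by
    intro g
    have h1 : (Fintype.piFinset fun v => if v ∈ U then {g v} else Finset.univ).card
        = k ^ (Fintype.card V - U.card) := by
      rw [Fintype.card_piFinset]
      simp only [apply_ite Finset.card, Finset.card_singleton, Finset.card_univ, Fintype.card_fin]
      rw [Finset.prod_ite, Finset.prod_const_one, one_mul, Finset.prod_const]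
      congr 1
      rw [Finset.filter_not, Finset.card_sdiff_of_subset (Finset.filter_subset _ _)]
      simp
    rw [← h1, ← Finset.card_map φ]
    refine Finset.card_le_card fun f hf => ?_
    obtain ⟨g', hg', rfl⟩ := Finset.mem_map.1 hf
    refine Finset.mem_filter.2 ⟨Finset.mem_univ _, fun v hv => ?_⟩
    have := Fintype.mem_piFinset.1 hg' v
    rw [if_pos hv, Finset.mem_singleton] at this
    rw [hφ, hφ, this]
  calc k ^ Fintype.card V * (k ^ (Fintype.card V - U.card)) ^ r
      = ∑ _g : V → Fin k, (k ^ (Fintype.card V - U.card)) ^ r := by simp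
    _ ≤ ∑ g : V → Fin k, (agreeing (φ g) U).card ^ r :=
        Finset.sum_le_sum fun g _ => Nat.pow_le_pow_left (hcard g) r
    _ = ∑ f ∈ Finset.univ.map φ, (agreeing f U).card ^ r := by rw [Finset.sum_map]
    _ ≤ ∑ f : V ↪ Fin n, (agreeing f U).card ^ r :=
        Finset.sum_le_sum_of_subset (Finset.subset_univ _)

lemma le_sum_card_agreeing_pow_real (hV : 0 < Fintype.card V) (hn : Fintype.card V ≤ n)
    (U : Finset V) (r : ℕ) :
    (1 / (2 * (Fintype.card V : ℝ))) ^ ((r + 1) * Fintype.card V) *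
        ((n : ℝ) ^ Fintype.card V * ((n : ℝ) ^ (Fintype.card V - U.card)) ^ r)
      ≤ ∑ f : V ↪ Fin n, ((agreeing f U).card : ℝ) ^ r := by
  set v := Fintype.card V with hv
  set k := n / v with hk
  have h1 : v * k ≤ n := Nat.mul_div_le n v
  have h2 : n ≤ 2 * v * k := by
    -- Since the quotient is at least 1, rounding down loses at most a factor 2.
    have h3 : 1 ≤ k := (Nat.one_le_div_iff hV).2 hn
    have h4 : n < v * (k + 1) := Nat.lt_mul_div_succ n hV
    nlinarith
  have hv0 : (0 : ℝ) < v := by exact_mod_cast hV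
  have h5 : (1 / (2 * (v : ℝ))) * n ≤ k := by
    rw [one_div, inv_mul_le_iff₀ (by positivity)]
    exact_mod_cast h2
  set c := 1 / (2 * (v : ℝ)) with hc
  have hc0 : 0 < c := by positivity
  have hc1 : c ≤ 1 := by
    rw [hc, div_le_one (by positivity)]
    have : (1 : ℝ) ≤ v := by exact_mod_cast hV
    linarith
  have h6 : ((k ^ v * (k ^ (v - U.card)) ^ r : ℕ) : ℝ)
      ≤ ((∑ f : V ↪ Fin n, (agreeing f U).card ^ r : ℕ) : ℝ) := by
    exact_mod_cast le_sum_card_agreeing_pow h1 U r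
  push_cast at h6
  refine le_trans ?_ h6
  calc c ^ ((r + 1) * v) * ((n : ℝ) ^ v * ((n : ℝ) ^ (v - U.card)) ^ r)
      ≤ (c ^ v * (c ^ (v - U.card)) ^ r) * ((n : ℝ) ^ v * ((n : ℝ) ^ (v - U.card)) ^ r) := by
        refine mul_le_mul_of_nonneg_right ?_ (by positivity)
        rw [← pow_mul, ← pow_add]
        refine pow_le_pow_of_le_one hc0.le hc1 ?_
        have : (v - U.card) * r ≤ v * r := Nat.mul_le_mul_right _ (Nat.sub_le _ _)
        nlinarith
    _ = (c * n) ^ v * ((c * n) ^ (v - U.card)) ^ r := by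
        simp only [mul_pow]
        ring
    _ ≤ (k : ℝ) ^ v * ((k : ℝ) ^ (v - U.card)) ^ r := by gcongr

lemma edgeImage_subset_of_mem_agreeing {D D₀ : Finset (Set V)} {U : Finset V} (hD : D₀ ⊆ D)
    (hU : ∀ e ∈ D₀, e ⊆ (U : Set V)) {f g : V ↪ Fin n} (hg : g ∈ agreeing f U) :
    edgeImage D₀ f ⊆ edgeImage D g := by
  intro s hs
  obtain ⟨e, he, rfl⟩ := Finset.mem_image.1 hs
  refine Finset.mem_image.2 ⟨e, hD he, ?_⟩
  exact Set.image_congr fun v hv => (Finset.mem_filter.1 hg).2 v (by simpa using hU e he hv)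

lemma self_mem_agreeing (f : V ↪ Fin n) (U : Finset V) : f ∈ agreeing f U := by
  simp [agreeing]

lemma entangled_of_subset {ι : Type*} [DecidableEq ι] {R A B C E : Finset ι} (hR : R.Nonempty)
    (hA : R ⊆ A) (hB : R ⊆ B) (hC : R ⊆ C) (hE : R ⊆ E) : Entangled A B C E := by
  obtain ⟨x, hx⟩ := hR
  have hA := hA hx
  have hB := hB hx
  have hC := hC hx
  have hE := hE hx
  simp only [Entangled, Finset.not_disjoint_iff]
  refine ⟨⟨⟨x, ?_⟩, ⟨x, ?_⟩, ⟨x, ?_⟩, ⟨x, ?_⟩⟩, ⟨x, ?_⟩, ⟨x, ?_⟩, ⟨x, ?_⟩⟩ <;>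
    simp [hA, hB, hC, hE]

lemma card_union_le_of_subset {ι : Type*} [DecidableEq ι] {R A B : Finset ι}
    (hA : R ⊆ A) (hB : R ⊆ B) : (A ∪ B).card ≤ A.card + (B.card - R.card) := by
  rw [← Finset.card_sdiff_of_subset hB]
  refine (Finset.card_le_card fun x hx => ?_).trans (Finset.card_union_le A (B \ R))
  simp only [Finset.mem_union, Finset.mem_sdiff] at hx ⊢
  grind

/-- All covariances are nonnegative, so only pairs agreeing on `U` are kept; these share the image
of `D₀`, which bounds the size of the union. -/
lemma le_sum_cov₂ {D D₀ : Finset (Set V)} {U : Finset V} (hD : D₀ ⊆ D) (hD₀ : D₀.Nonempty)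
    (hU : ∀ e ∈ D₀, e ⊆ (U : Set V)) (hV : 0 < Fintype.card V) (hn : Fintype.card V ≤ n)
    {p : ℝ} (hp : 0 < p) (hp1 : p ≤ 1 / 26) :
    1 / 2 * (1 / (2 * (Fintype.card V : ℝ))) ^ (2 * Fintype.card V) *
        (((n : ℝ) ^ Fintype.card V * p ^ D.card) ^ 2 / ((n : ℝ) ^ U.card * p ^ D₀.card))
      ≤ ∑ f : V ↪ Fin n, ∑ g : V ↪ Fin n, cov₂ p (edgeImage D f) (edgeImage D g) := by
  have hp1' : p ≤ 1 := by linarith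
  have h0 : ∀ A B : Finset (Set (Fin n)), 0 ≤ cov₂ p A B := by
    intro A B
    by_cases h : Disjoint A B
    · rw [cov₂_eq_zero p h]
    · exact le_trans (mul_nonneg (by linarith) (by positivity)) (cov₂_bounds hp.le hp1' h).1
  set c := 1 / 2 * p ^ (D.card + (D.card - D₀.card)) with hc
  have h1 : ∀ f g : V ↪ Fin n, g ∈ agreeing f U → c ≤ cov₂ p (edgeImage D f) (edgeImage D g) := by
    intro f g hg
    have hf := edgeImage_subset_of_mem_agreeing hD hU (self_mem_agreeing f U)
    have hg := edgeImage_subset_of_mem_agreeing hD hU hg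
    have hne : (edgeImage D₀ f).Nonempty := hD₀.image _
    have hd : ¬ Disjoint (edgeImage D f) (edgeImage D g) := by
      obtain ⟨x, hx⟩ := hne
      exact Finset.not_disjoint_iff.2 ⟨x, hf hx, hg hx⟩
    have hcard := card_union_le_of_subset hf hg
    simp only [card_edgeImage] at hcard
    refine le_trans ?_ (cov₂_bounds hp.le hp1' hd).1
    exact mul_le_mul (by linarith) (pow_le_pow_of_le_one hp.le hp1' hcard) (by positivity)
      (by linarith)
  have hn0 : (0 : ℝ) < n := by
    have : 0 < n := by omega
    exact_mod_cast this
  have hle : U.card ≤ Fintype.card V := Finset.card_le_univ U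
  have hle' : D₀.card ≤ D.card := Finset.card_le_card hD
  calc _ = c * ((1 / (2 * (Fintype.card V : ℝ))) ^ ((1 + 1) * Fintype.card V) *
        ((n : ℝ) ^ Fintype.card V * ((n : ℝ) ^ (Fintype.card V - U.card)) ^ 1)) := by
        rw [hc, pow_add, pow_sub₀ _ hp.ne' hle', pow_sub₀ _ hn0.ne' hle]
        field_simp
    _ ≤ c * ∑ f : V ↪ Fin n, ((agreeing f U).card : ℝ) ^ 1 :=
        mul_le_mul_of_nonneg_left (le_sum_card_agreeing_pow_real hV hn U 1) (by positivity)
    _ = ∑ f : V ↪ Fin n, ∑ g ∈ agreeing f U, c := by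
        simp [Finset.mul_sum, mul_comm]
    _ ≤ _ := by
        refine Finset.sum_le_sum fun f _ => ?_
        refine (Finset.sum_le_sum fun g hg => h1 f g hg).trans ?_
        exact Finset.sum_le_sum_of_subset_of_nonneg (Finset.subset_univ _) fun _ _ _ => h0 _ _

lemma le_sum_cumulant₄ {D D₀ : Finset (Set V)} {U : Finset V} (hD : D₀ ⊆ D) (hD₀ : D₀.Nonempty)
    (hU : ∀ e ∈ D₀, e ⊆ (U : Set V)) (hV : 0 < Fintype.card V) (hn : Fintype.card V ≤ n)
    {p : ℝ} (hp : 0 < p) (hp1 : p ≤ 1 / 26) :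
    1 / 2 * (1 / (2 * (Fintype.card V : ℝ))) ^ (4 * Fintype.card V) *
        (((n : ℝ) ^ Fintype.card V * p ^ D.card) ^ 4 / ((n : ℝ) ^ U.card * p ^ D₀.card) ^ 3)
      ≤ ∑ f₁ : V ↪ Fin n, ∑ f₂ : V ↪ Fin n, ∑ f₃ : V ↪ Fin n, ∑ f₄ : V ↪ Fin n,
      cumulant₄ p (edgeImage D f₁) (edgeImage D f₂) (edgeImage D f₃) (edgeImage D f₄) := by
  have hp1' : p ≤ 1 := by linarith
  have h0 : ∀ A B C E : Finset (Set (Fin n)), 0 ≤ cumulant₄ p A B C E := by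
    intro A B C E
    by_cases h : Entangled A B C E
    · exact le_trans (mul_nonneg (by linarith) (by positivity)) (cumulant₄_bounds hp.le hp1' h).1
    · rw [cumulant₄_eq_zero p h]
  -- The factor 1/2 bounds 1 - 13p from below for p ≤ 1/26; each of the three further copies adds at
  -- most |D| - |D₀| new edges.
  set c := 1 / 2 * p ^ (D.card + (D.card - D₀.card) * 3) with hc
  have h1 : ∀ f₁ f₂ f₃ f₄ : V ↪ Fin n, f₂ ∈ agreeing f₁ U → f₃ ∈ agreeing f₁ U →
      f₄ ∈ agreeing f₁ U →
      c ≤ cumulant₄ p (edgeImage D f₁) (edgeImage D f₂) (edgeImage D f₃) (edgeImage D f₄) := by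
    intro f₁ f₂ f₃ f₄ h₂ h₃ h₄
    have h₁ := edgeImage_subset_of_mem_agreeing hD hU (self_mem_agreeing f₁ U)
    have h₂ := edgeImage_subset_of_mem_agreeing hD hU h₂
    have h₃ := edgeImage_subset_of_mem_agreeing hD hU h₃
    have h₄ := edgeImage_subset_of_mem_agreeing hD hU h₄
    have hne : (edgeImage D₀ f₁).Nonempty := hD₀.image _
    have hent := entangled_of_subset hne h₁ h₂ h₃ h₄
    have c1 := card_union_le_of_subset h₁ h₂
    have c2 := card_union_le_of_subset (h₁.trans Finset.subset_union_left) h₃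
      (A := edgeImage D f₁ ∪ edgeImage D f₂)
    have c3 := card_union_le_of_subset
      (h₁.trans (Finset.subset_union_left.trans Finset.subset_union_left)) h₄
      (A := edgeImage D f₁ ∪ edgeImage D f₂ ∪ edgeImage D f₃)
    simp only [card_edgeImage] at c1 c2 c3
    refine le_trans ?_ (cumulant₄_bounds hp.le hp1' hent).1
    exact mul_le_mul (by linarith) (pow_le_pow_of_le_one hp.le hp1' (by omega)) (by positivity)
      (by linarith)
  have hn0 : (0 : ℝ) < n := by
    have : 0 < n := by omega
    exact_mod_cast this
  have hle : U.card ≤ Fintype.card V := Finset.card_le_univ U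
  have hle' : D₀.card ≤ D.card := Finset.card_le_card hD
  have hmono : ∀ (s : Finset (V ↪ Fin n)) (F G : (V ↪ Fin n) → ℝ), (∀ f ∈ s, F f ≤ G f) →
      (∀ f, 0 ≤ G f) → ∑ f ∈ s, F f ≤ ∑ f, G f := fun s F G hFG hG =>
    (Finset.sum_le_sum hFG).trans
      (Finset.sum_le_sum_of_subset_of_nonneg (Finset.subset_univ _) fun _ _ _ => hG _)
  calc _ = c * ((1 / (2 * (Fintype.card V : ℝ))) ^ ((3 + 1) * Fintype.card V) *
        ((n : ℝ) ^ Fintype.card V * ((n : ℝ) ^ (Fintype.card V - U.card)) ^ 3)) := by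
        rw [hc, pow_add, pow_mul p, pow_sub₀ _ hp.ne' hle', pow_sub₀ _ hn0.ne' hle]
        field_simp
    _ ≤ c * ∑ f : V ↪ Fin n, ((agreeing f U).card : ℝ) ^ 3 :=
        mul_le_mul_of_nonneg_left (le_sum_card_agreeing_pow_real hV hn U 3) (by positivity)
    _ = ∑ f : V ↪ Fin n, ∑ _g ∈ agreeing f U, ∑ _g ∈ agreeing f U, ∑ _g ∈ agreeing f U, c := by
        rw [Finset.mul_sum]
        refine Finset.sum_congr rfl fun f _ => ?_
        simp only [Finset.sum_const, nsmul_eq_mul]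
        ring
    _ ≤ _ := by
        refine Finset.sum_le_sum fun f₁ _ => ?_
        refine hmono _ _ _ (fun f₂ h₂ => ?_) fun f₂ => Finset.sum_nonneg fun _ _ =>
          Finset.sum_nonneg fun _ _ => h0 _ _ _ _
        refine hmono _ _ _ (fun f₃ h₃ => ?_) fun f₃ => Finset.sum_nonneg fun _ _ => h0 _ _ _ _
        exact hmono _ _ _ (fun f₄ h₄ => h1 _ _ _ _ h₂ h₃ h₄) fun f₄ => h0 _ _ _ _

end LowerBounds

/-! ### From copies to embeddings -/

section Copies

variable {α : Type*} {n : ℕ}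

/-- The edges of `H`, as sets of elements of the subtype of vertices. -/
def innerEdges (H : Hypergraph α) : Set (Set V(H)) :=
  {e | (Subtype.val '' e : Set α) ∈ E(H)}

/-- The copy of `H` given by an embedding of its vertices. -/
def copyOf (H : Hypergraph α) (f : V(H) ↪ Fin n) : Hypergraph (Fin n) where
  vertexSet := Set.range f
  edgeSet := (fun e => f '' e) '' innerEdges H
  subset_vertexSet_of_mem_edgeSet' := by
    rintro _ ⟨e, -, rfl⟩
    exact Set.image_subset_range _ _

lemma exists_image_val_eq {H : Hypergraph α} {s : Set α} (hs : s ∈ E(H)) :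
    ∃ e : Set V(H), Subtype.val '' e = s :=
  ⟨Subtype.val ⁻¹' s, by
    rw [Subtype.image_preimage_coe, Set.inter_eq_right]
    exact H.subset_vertexSet_of_mem_edgeSet' hs⟩

lemma mem_edgeSet_copyOf {H : Hypergraph α} {f : V(H) ↪ Fin n} {e : Set V(H)} :
    f '' e ∈ E(copyOf H f) ↔ e ∈ innerEdges H :=
  f.injective.image_injective.mem_set_image

lemma mem_copies {H : Hypergraph α} {H' : Hypergraph (Fin n)} :
    H' ∈ copies H n ↔ IsSub H' (complete n) ∧ Iso H' H := by
  simp [copies]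

lemma copyOf_mem_copies {H : Hypergraph α} (hne : ∅ ∉ E(H)) (f : V(H) ↪ Fin n) :
    copyOf H f ∈ copies H n := by
  rw [mem_copies]
  refine ⟨⟨Set.subset_univ _, ?_⟩, (Equiv.ofInjective f f.injective).symm, fun e => ?_⟩
  · rintro _ ⟨e, he, rfl⟩
    refine Set.Nonempty.image _ (Set.nonempty_iff_ne_empty.2 ?_)
    rintro rfl
    exact hne (by simpa [innerEdges] using he)
  · have h : ∀ e : Set (Set.range f), (Subtype.val '' e : Set (Fin n))
        = f '' ((Equiv.ofInjective f f.injective).symm '' e) := fun e => by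
      rw [Set.image_image]
      exact Set.image_congr fun y _ => (Equiv.apply_ofInjective_symm f.injective y).symm
    exact (iff_of_eq (congrArg (· ∈ E(copyOf H f)) (h e))).trans mem_edgeSet_copyOf

lemma exists_copyOf_eq {H : Hypergraph α} {H' : Hypergraph (Fin n)} (h : H' ∈ copies H n) :
    ∃ f : V(H) ↪ Fin n, copyOf H f = H' := by
  obtain ⟨-, g, hg⟩ := mem_copies.1 h
  have himg : ∀ e : Set V(H'), (fun v => ((g.symm v : V(H')) : Fin n)) '' (g '' e)
      = Subtype.val '' e := by
    intro e
    simp [Set.image_image]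
  refine ⟨g.symm.toEmbedding.trans (Function.Embedding.subtype _), Hypergraph.ext ?_ ?_⟩
  · change Set.range (fun v => ((g.symm v : V(H')) : Fin n)) = V(H')
    have := himg Set.univ
    rwa [Set.image_univ, Equiv.range_eq_univ, Set.image_univ, Set.image_univ,
      Subtype.range_coe] at this
  · ext s
    change s ∈ (fun e => (fun v => ((g.symm v : V(H')) : Fin n)) '' e) '' innerEdges H ↔ s ∈ E(H')
    constructor
    · rintro ⟨e, he, rfl⟩
      have h1 : e = g '' (g.symm '' e) := by simp [Set.image_image]
      have h2 := (hg (g.symm '' e)).2 (by rw [← h1]; exact he)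
      simp only
      rwa [h1, himg]
    · intro hs
      obtain ⟨e, rfl⟩ := exists_image_val_eq hs
      exact ⟨g '' e, (hg e).1 hs, himg e⟩

/-- The automorphisms of `H`. -/
def automorphisms (H : Hypergraph α) : Set (Equiv.Perm V(H)) :=
  {σ | ∀ e, σ '' e ∈ innerEdges H ↔ e ∈ innerEdges H}

/-- Embeddings with the same copy have the same range, so they differ by a permutation of the
vertices, which must preserve the edges. -/
lemma copyOf_eq_copyOf_iff {H : Hypergraph α} {f g : V(H) ↪ Fin n} :
    copyOf H g = copyOf H f ↔ ∃ σ ∈ automorphisms H, σ.toEmbedding.trans f = g := by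
  constructor
  · intro h
    have hr : Set.range g = Set.range f := congrArg Hypergraph.vertexSet h
    let σ : Equiv.Perm V(H) := (Equiv.ofInjective g g.injective).trans
      ((Equiv.setCongr hr).trans (Equiv.ofInjective f f.injective).symm)
    have hσ : σ.toEmbedding.trans f = g := by
      ext v
      simp [σ, Equiv.apply_ofInjective_symm f.injective]
    refine ⟨σ, fun e => ?_, hσ⟩
    have h1 : f '' (σ '' e) = g '' e := by
      rw [← hσ, Set.image_image]
      rfl
    rw [← mem_edgeSet_copyOf (f := f), h1, ← h, mem_edgeSet_copyOf]
  · rintro ⟨σ, hσ, rfl⟩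
    have himg : ∀ e : Set V(H), (σ.toEmbedding.trans f) '' e = f '' (σ '' e) := fun e => by
      rw [Set.image_image]
      rfl
    refine Hypergraph.ext ?_ ?_
    · change Set.range (f ∘ σ) = Set.range f
      exact σ.surjective.range_comp f
    · ext s
      constructor
      · rintro ⟨e, he, rfl⟩
        exact ⟨σ '' e, (hσ e).2 he, (himg e).symm⟩
      · rintro ⟨e, he, rfl⟩
        have h1 : e = σ '' (σ.symm '' e) := by simp [Set.image_image]
        refine ⟨σ.symm '' e, (hσ _).1 (by rwa [← h1]), ?_⟩
        simp only
        rw [himg, ← h1]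

lemma isSub_ofEdges_iff {H' : Hypergraph (Fin n)} {S : Set (Set (Fin n))} :
    IsSub H' (ofEdges S) ↔ E(H') ⊆ S :=
  ⟨fun h => h.2, fun h => ⟨Set.subset_univ _, h⟩⟩

open scoped Classical

variable {H : Hypergraph α} [Fintype V(H)]

/-- The edges of `H` as a finite family of sets of vertices. -/
noncomputable def edgeFamily (H : Hypergraph α) [Fintype V(H)] : Finset (Set V(H)) :=
  (innerEdges H).toFinset

lemma mem_edgeFamily {e : Set V(H)} : e ∈ edgeFamily H ↔ (Subtype.val '' e : Set α) ∈ E(H) := by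
  rw [edgeFamily, Set.mem_toFinset]
  rfl

lemma coe_edgeImage (f : V(H) ↪ Fin n) :
    (edgeImage (edgeFamily H) f : Set (Set (Fin n))) = E(copyOf H f) := by
  simp [edgeImage, edgeFamily, copyOf]

lemma edgeImage_subset_possibleEdges (hne : ∅ ∉ E(H)) (f : V(H) ↪ Fin n) :
    (edgeImage (edgeFamily H) f : Set (Set (Fin n))) ⊆ possibleEdges n := by
  rw [coe_edgeImage]
  exact (mem_copies.1 (copyOf_mem_copies hne f)).1.2

lemma card_filter_copyOf_eq (f : V(H) ↪ Fin n) :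
    (Finset.univ.filter fun g : V(H) ↪ Fin n => copyOf H g = copyOf H f).card
      = (automorphisms H).toFinset.card := by
  symm
  refine Finset.card_bij (fun σ _ => σ.toEmbedding.trans f) ?_ ?_ ?_
  · intro σ hσ
    refine Finset.mem_filter.2 ⟨Finset.mem_univ _, copyOf_eq_copyOf_iff.2 ⟨σ, ?_, rfl⟩⟩
    simpa using hσ
  · intro σ _ τ _ h
    ext v
    have := f.injective (DFunLike.congr_fun h v)
    exact congrArg Subtype.val this
  · intro g hg
    obtain ⟨σ, hσ, h⟩ := copyOf_eq_copyOf_iff.1 (Finset.mem_filter.1 hg).2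
    exact ⟨σ, by simpa using hσ, h⟩

lemma card_automorphisms_pos : 0 < (automorphisms H).toFinset.card := by
  refine Finset.card_pos.2 ⟨1, Set.mem_toFinset.2 fun e => ?_⟩
  simp

/-- Each fibre of the map from embeddings to copies is an orbit of the automorphisms, acting freely.
-/
lemma sum_containsInd_eq_card_mul_count (hne : ∅ ∉ E(H)) (S : Set (Set (Fin n))) :
    ∑ f : V(H) ↪ Fin n, containsInd (edgeImage (edgeFamily H) f) S
      = (automorphisms H).toFinset.card * count H n S := by
  rw [count, Finset.mul_sum, ← Finset.sum_fiberwise_of_maps_to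
    (fun f _ => copyOf_mem_copies hne f : ∀ f ∈ Finset.univ, copyOf H f ∈ copies H n)]
  refine Finset.sum_congr rfl fun H' hH' => ?_
  obtain ⟨f, rfl⟩ := exists_copyOf_eq hH'
  rw [Finset.sum_congr rfl (g := fun _ =>
    Set.indicator {S | IsSub (copyOf H f) (ofEdges S)} (fun _ => (1 : ℝ)) S),
    Finset.sum_const, card_filter_copyOf_eq, nsmul_eq_mul]
  intro g hg
  rw [containsInd, coe_edgeImage, (Finset.mem_filter.1 hg).2]
  simp only [isSub_ofEdges_iff]

lemma isSubBound_minTerm (hE : E(H).Nonempty) (n : ℕ) (p : ℝ) :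
    IsSubBound (edgeFamily H) n p (minTerm H n p) := by
  intro U D' hD' hne hU
  let F : Hypergraph α :=
    { vertexSet := Subtype.val '' (U : Set V(H))
      edgeSet := (fun e : Set V(H) => (Subtype.val '' e : Set α)) '' (D' : Set (Set V(H)))
      subset_vertexSet_of_mem_edgeSet' := by
        rintro _ ⟨e, he, rfl⟩
        exact Set.image_mono (hU e he) }
  have hVF : V(F).ncard = U.card := by
    change (Subtype.val '' (U : Set V(H))).ncard = _
    rw [Set.ncard_image_of_injective _ Subtype.val_injective, Set.ncard_coe_finset]
  have hEF : E(F).ncard = D'.card := by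
    change ((fun e : Set V(H) => (Subtype.val '' e : Set α)) '' (D' : Set (Set V(H)))).ncard = _
    rw [Set.ncard_image_of_injective _ Subtype.val_injective.image_injective,
      Set.ncard_coe_finset]
  have hF : F ∈ subsWithEdge H := by
    refine ⟨⟨?_, ?_⟩, ?_⟩
    · rintro _ ⟨v, -, rfl⟩
      exact v.2
    · rintro _ ⟨e, he, rfl⟩
      exact mem_edgeFamily.1 (hD' he)
    · rw [hEF]
      exact Finset.card_pos.2 hne
  have := (isLeast_minTerm H (Set.toFinite _) hE n p).2 ⟨F, hF, rfl⟩
  simpa only [hVF, hEF] using this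

/-- A minimizing subhypergraph, rewritten on the vertex subtype, provides the shared part in the
lower bounds. -/
lemma exists_minTerm_eq (hE : E(H).Nonempty) (n : ℕ) (p : ℝ) :
    ∃ U : Finset V(H), ∃ D₀ ⊆ edgeFamily H, D₀.Nonempty ∧ (∀ e ∈ D₀, e ⊆ (U : Set V(H))) ∧
      minTerm H n p = (n : ℝ) ^ U.card * p ^ D₀.card := by
  obtain ⟨F, ⟨⟨hV, hEF⟩, hcard⟩, hF⟩ := (isLeast_minTerm H (Set.toFinite _) hE n p).1
  set U : Finset V(H) := Finset.univ.filter fun v => (v : α) ∈ V(F) with hU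
  set D₀ := (edgeFamily H).filter fun e => (Subtype.val '' e : Set α) ∈ E(F) with hD₀
  have hVU : V(F) = Subtype.val '' (U : Set V(H)) := by
    ext x
    simp only [hU, Finset.coe_filter, Finset.mem_univ, true_and, Set.mem_image,
      Set.mem_ofPred_eq, Subtype.exists, exists_and_left, exists_prop, exists_eq_right_right]
    exact ⟨fun h => ⟨h, hV h⟩, fun h => h.1⟩
  have hED : E(F) = (fun e : Set V(H) => (Subtype.val '' e : Set α)) '' (D₀ : Set (Set V(H))) := by
    ext s
    constructor
    · intro hs
      obtain ⟨e, rfl⟩ := exists_image_val_eq (hEF hs)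
      exact ⟨e, Finset.mem_filter.2 ⟨mem_edgeFamily.2 (hEF hs), hs⟩, rfl⟩
    · rintro ⟨e, he, rfl⟩
      exact (Finset.mem_filter.1 he).2
  have hVc : V(F).ncard = U.card := by
    rw [hVU, Set.ncard_image_of_injective _ Subtype.val_injective, Set.ncard_coe_finset]
  have hEc : E(F).ncard = D₀.card := by
    rw [hED, Set.ncard_image_of_injective _ Subtype.val_injective.image_injective,
      Set.ncard_coe_finset]
  refine ⟨U, D₀, Finset.filter_subset _ _, ?_, ?_, ?_⟩
  · rw [← Finset.card_pos, ← hEc]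
    exact hcard
  · intro e he v hv
    have := F.subset_vertexSet_of_mem_edgeSet' (Finset.mem_filter.1 he).2 ⟨v, hv, rfl⟩
    simpa [hU] using this
  · rw [← hF, ← hVc, ← hEc]

end Copies

/-! ### Standardization and the final comparison -/

lemma standardize_const_mul {Ω : Type*} [MeasurableSpace Ω] (μ : Measure Ω) (X : Ω → ℝ) {c : ℝ}
    (hc : 0 < c) : standardize μ (fun ω => c * X ω) = standardize μ X := by
  funext ω
  simp only [standardize]
  rw [integral_const_mul, variance_const_mul, Real.sqrt_mul (sq_nonneg c), Real.sqrt_sq hc.le,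
    ← mul_sub, mul_div_mul_left _ _ hc.ne']

lemma integral_standardize_pow_four {Ω : Type*} [MeasurableSpace Ω] (μ : Measure Ω) (X : Ω → ℝ)
    (hX : 0 < variance X μ) :
    ∫ ω, standardize μ X ω ^ 4 ∂μ
      = (∫ ω, (X ω - ∫ ω', X ω' ∂μ) ^ 4 ∂μ) / variance X μ ^ 2 := by
  have h : √(variance X μ) ^ 4 = variance X μ ^ 2 := by
    rw [show 4 = 2 * 2 from rfl, pow_mul, Real.sq_sqrt hX.le]
  simp only [standardize, div_pow, h]
  rw [integral_div]

end RandomHypergraph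

open RandomHypergraph

theorem theorem5p3 {α : Type*} (H : Hypergraph α) (hV : V(H).Finite) (hE : E(H).Nonempty)
    (hne : ∅ ∉ E(H)) :
    ∃ ε : ℝ, 0 < ε ∧ ∃ C₁ C₂ : ℝ, 0 < C₁ ∧ 0 < C₂ ∧ ∃ n₀ : ℕ,
      ∀ n : ℕ, n₀ ≤ n → ∀ p : unitInterval, 0 < (p : ℝ) → (p : ℝ) < 1 → (p : ℝ) < ε →
        C₁ * (1 / RandomHypergraph.minTerm H n p) ≤
            (∫ S, RandomHypergraph.standardize (RandomHypergraph.model n p)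
              (RandomHypergraph.count H n) S ^ 4 ∂(RandomHypergraph.model n p)) - 3 ∧
          (∫ S, RandomHypergraph.standardize (RandomHypergraph.model n p)
              (RandomHypergraph.count H n) S ^ 4 ∂(RandomHypergraph.model n p)) - 3 ≤
            C₂ * (1 / RandomHypergraph.minTerm H n p) := by
  classical
  have : Fintype V(H) := hV.fintype
  set v := Fintype.card V(H) with hv
  have hv0 : 0 < v := by
    obtain ⟨s, hs⟩ := hE
    obtain ⟨x, hx⟩ := Set.nonempty_iff_ne_empty.2 (fun h : s = ∅ => hne (h ▸ hs))
    exact Fintype.card_pos_iff.2 ⟨⟨x, H.subset_vertexSet_of_mem_edgeSet' hs hx⟩⟩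
  have hv0' : (0 : ℝ) < v := by exact_mod_cast hv0
  set a₂ : ℝ := 1 / 2 * (1 / (2 * (v : ℝ))) ^ (2 * v) with ha₂
  set b₂ : ℝ := ((v : ℝ) + 1) ^ v with hb₂
  set a₄ : ℝ := 1 / 2 * (1 / (2 * (v : ℝ))) ^ (4 * v) with ha₄
  set b₄ : ℝ := 78 * (3 * (v : ℝ) + 1) ^ (3 * v) with hb₄
  have ha₂0 : 0 < a₂ := by positivity
  have hb₂0 : 0 < b₂ := by positivity
  have ha₄0 : 0 < a₄ := by positivity
  have hb₄0 : 0 < b₄ := by positivity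
  -- The bound 1/26 gives 1 - 13p ≥ 1/2, and n ≥ `v` leaves room for an embedding. Each constant
  -- pairs a cumulant bound with the opposite variance bound.
  refine ⟨1 / 26, by norm_num, a₄ / b₂ ^ 2, b₄ / a₂ ^ 2, by positivity, by positivity, v,
    fun n hn p hp0 hp1 hpε => ?_⟩
  have hn0 : (0 : ℝ) < n := by
    have : 0 < n := by omega
    exact_mod_cast this
  set D := edgeFamily H
  set m := minTerm H n p with hm
  set X : Set (Set (Fin n)) → ℝ := fun S => ∑ f : V(H) ↪ Fin n, containsInd (edgeImage D f) S
    with hX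
  have hmin : IsSubBound D n p m := isSubBound_minTerm hE n p
  obtain ⟨U, D₀, hD₀, hD₀ne, hU, hmU⟩ := exists_minTerm_eq hE n (p : ℝ)
  rw [← hm] at hmU
  have hm0 : 0 < m := by rw [hmU]; positivity
  set A : ℝ := (n : ℝ) ^ v * (p : ℝ) ^ D.card with hA
  have hA0 : 0 < A := by positivity
  have hR := fun f : V(H) ↪ Fin n => edgeImage_subset_possibleEdges hne f
  have hvar := variance_sum_containsInd p hR
  have hfour := fourth_moment_sum_containsInd p hR
  have v1 := le_sum_cov₂ hD₀ hD₀ne hU hv0 hn hp0 hpε.le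
  have v2 := sum_cov₂_le hp0 hp1.le hm0 hmin
  have k1 := le_sum_cumulant₄ hD₀ hD₀ne hU hv0 hn hp0 hpε.le
  have k2 := sum_cumulant₄_le hp0 hp1.le hm0 hmin
  rw [← hmU] at v1 k1
  rw [← hvar] at v1 v2
  set T := ∑ f₁ : V(H) ↪ Fin n, ∑ f₂ : V(H) ↪ Fin n, ∑ f₃ : V(H) ↪ Fin n, ∑ f₄ : V(H) ↪ Fin n,
    cumulant₄ (p : ℝ) (edgeImage D f₁) (edgeImage D f₂) (edgeImage D f₃) (edgeImage D f₄) with hT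
  change a₂ * (A ^ 2 / m) ≤ variance X (model n p) at v1
  change variance X (model n p) ≤ b₂ * (A ^ 2 / m) at v2
  change a₄ * (A ^ 4 / m ^ 3) ≤ T at k1
  change T ≤ b₄ * (A ^ 4 / m ^ 3) at k2
  change ∫ S, (X S - ∫ S', X S' ∂(model n p)) ^ 4 ∂(model n p)
    = T + 3 * variance X (model n p) ^ 2 at hfour
  have hvar0 : 0 < variance X (model n p) := lt_of_lt_of_le (by positivity) v1
  have hstd : standardize (model n p) (count H n) = standardize (model n p) X := by
    rw [← standardize_const_mul (model n p) (count H n)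
      (Nat.cast_pos.2 (card_automorphisms_pos (H := H)) :
        (0 : ℝ) < ((automorphisms H).toFinset.card : ℝ))]
    congr 1
    funext S
    exact (sum_containsInd_eq_card_mul_count hne S).symm
  rw [hstd, integral_standardize_pow_four _ _ hvar0, hfour]
  set σ := variance X (model n p)
  -- The Gaussian value 3 is exactly the contribution of the three pairings.
  have hkey : (T + 3 * σ ^ 2) / σ ^ 2 - 3 = T / σ ^ 2 := by
    field_simp
    ring
  rw [hkey, le_div_iff₀ (by positivity), div_le_iff₀ (by positivity)]
  constructor
  · calc a₄ / b₂ ^ 2 * (1 / m) * σ ^ 2 ≤ a₄ / b₂ ^ 2 * (1 / m) * (b₂ * (A ^ 2 / m)) ^ 2 := by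
          gcongr
      _ = a₄ * (A ^ 4 / m ^ 3) := by field_simp
      _ ≤ T := k1
  · calc T ≤ b₄ * (A ^ 4 / m ^ 3) := k2
      _ = b₄ / a₂ ^ 2 * (1 / m) * (a₂ * (A ^ 2 / m)) ^ 2 := by field_simp
      _ ≤ b₄ / a₂ ^ 2 * (1 / m) * σ ^ 2 := by gcongr
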